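/- Let $X$ be a Banach space, $U$ a normed space, $\mathcal U=L^\infty(\mathbb R_+,U)$ with the essential supremum norm, and let $\mathcal D$ and $D$ be the closed unit balls of $\mathcal U$ and $U$. Let $A$ generate a $C_0$-semigroup $(T(t))_{t\ge 0}$ on $X$ and let $f:X\times U\to X$ be such that $s\mapsto f(x(s),u(s))$ is strongly measurable for every continuous $x$ and every $u\in\mathcal U$ (for example, $f$ continuous). Consider $$\Sigma:\quad \dot x(t)=Ax(t)+f(x(t),u(t)),\qquad t\ge 0,\ u\in\mathcal U .$$ A mild solution on $[0,\tau]$ is a continuous $x$ with $x(t)=T(t)x_0+\int_0^tT(t-s)f(x(s),u(s))\,ds$ for $t\in[0,\tau]$ (with integrable integrand). Assume that $\Sigma$ is well-posed: for all $x_0\in X$, $u\in\mathcal U$ there is a mild solution on some $[0,\tau]$, $\tau>0$, and two mild solutions on the same interval coincide. Write $\phi(t,x_0,u)$ for the solution; $\Sigma$ is forward complete if $\phi(t,x_0,u)$ is defined for all $t\ge0$, $x_0\in X$, $u\in\mathcal U$. $\mathcal K_\infty$ is the set of continuous, strictly increasing, unbounded $\eta:\mathbb R_+\to\mathbb R_+$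 with $\eta(0)=0$. For $\eta\in\mathcal K_\infty$, $x\in X$ let $\mathcal U_x^\eta=\{v\in\mathcal U:\ \|v(\theta)\|_U\le\eta(\|\phi(\theta,x,v)\|_X)\text{ for a.e. }\theta\ge0\}$, and let $\Sigma_\eta$ be the closed-loop system, with disturbances $d\in\mathcal D$ as inputs, $$\Sigma_\eta:\quad \dot x(t)=Ax(t)+f\bigl(x(t),d(t)\,\eta(\|x(t)\|_X)\bigr),\qquad t\ge0,$$ whose mild solutions, well-posedness, forward completeness and flow $\phi_\eta(t,x,d)$ are defined as for $\Sigma$. * $\Sigma$ is robustly forward complete with respect to trajectory-dominated inputs with growth margin $\eta$ if it is forward complete and $\sup\{\|\phi(t,x,u)\|_X:\ \|x\|_X<C,\ u\in\mathcal U_x^\eta,\ 0\le t<\tau\}<\infty$ for all $C>0$, $\tau\ge0$; it is robustly forward complete with respect to trajectory-dominated inputs if this holds for some $\eta\in\mathcal K_\infty$. * $\Sigma$ has bounded reachability sets (BRS) if it is forward complete and $\sup\{\|\phi(t,x,u)\|_X:\ \|x\|_X<C,\ \|u\|_{\mathcal U}<C,\ 0\le t<\tau\}<\infty$ for all $C>0$,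 $\tau\ge0$. * $\Sigma_\eta$ is robustly forward complete with respect to inputs in $\mathcal D$ if it is forward complete and $\sup\{\|\phi_\eta(t,x,d)\|_X:\ \|x\|_X<C,\ d\in\mathcal D,\ 0\le t<\tau\}<\infty$ for all $C>0$, $\tau\ge0$. Assume that there is $\eta\in\mathcal K_\infty$, globally Lipschitz with constant $1$, such that $\Sigma$ is robustly forward complete with respect to trajectory-dominated inputs with growth margin $\eta$ and such that for each $C>0$ there is $L_C>0$ with $$\bigl\|f(x_1,d\,\eta(\|x_1\|_X))-f(x_2,d\,\eta(\|x_2\|_X))\bigr\|_X\le L_C\|x_1-x_2\|_X\quad\text{whenever }\|x_1\|_X,\|x_2\|_X<C,\ d\in D .$$ Then the following are equivalent: 1. There is $\eta\in\mathcal K_\infty$ such that $\Sigma_\eta$ is well-posed and robustly forward complete with respect to inputs in $\mathcal D$. 2. $\Sigma$ is robustly forward complete with respect to trajectory-dominated inputs. 3. $\Sigma$ has bounded reachability sets. -/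

import Mathlib

open MeasureTheory Set Filter Topology
open scoped NNReal ENNReal

noncomputable section

namespace SemilinearEvolution

/-! ### Comparison functions -/

/-- Class `K_∞`: continuous, zero at zero, strictly increasing and unbounded functions
on the nonnegative reals. -/
structure ClassKInfty (γ : ℝ≥0 → ℝ≥0) : Prop where
  map_zero : γ 0 = 0
  continuous : Continuous γ
  strictMono : StrictMono γ
  unbounded : ∀ M : ℝ≥0, ∃ s : ℝ≥0, M < γ s

/-! ### Strongly continuous semigroups and their generators -/

/-- A `C₀`-semigroup of bounded linear operators on `X`. Only the values `T t` with `0 ≤ t`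
are meaningful. -/
structure C0Semigroup (X : Type*) [NormedAddCommGroup X] [NormedSpace ℝ X] where
  toFun : ℝ → X →L[ℝ] X
  map_zero : toFun 0 = ContinuousLinearMap.id ℝ X
  map_add : ∀ s t : ℝ, 0 ≤ s → 0 ≤ t → toFun (s + t) = (toFun s).comp (toFun t)
  tendsto_zero : ∀ x : X, Tendsto (fun t : ℝ => toFun t x) (𝓝[>] 0) (𝓝 x)

instance {X : Type*} [NormedAddCommGroup X] [NormedSpace ℝ X] :
    CoeFun (C0Semigroup X) (fun _ => ℝ → X →L[ℝ] X) := ⟨C0Semigroup.toFun⟩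

/-- `A` is the infinitesimal generator of `T`: `x ∈ D(A)` with `A x = y` if and only if
`(T t x - x) / t → y` as `t ↓ 0`. -/
def IsGenerator {X : Type*} [NormedAddCommGroup X] [NormedSpace ℝ X]
    (A : X →ₗ.[ℝ] X) (T : C0Semigroup X) : Prop :=
  ∀ x y : X, (x, y) ∈ A.graph ↔
    Tendsto (fun t : ℝ => t⁻¹ • (T t x - x)) (𝓝[>] 0) (𝓝 y)

/-! ### Inputs -/

/-- The space of admissible inputs `L^∞(ℝ₊, U)` with the essential supremum norm. -/
abbrev Input (U : Type*) [NormedAddCommGroup U] : Type _ :=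
  Lp U ∞ ((volume : Measure ℝ).restrict (Ici 0))

/-- The closed unit ball of `L^∞(ℝ₊, U)`. -/
abbrev Disturbance (U : Type*) [NormedAddCommGroup U] : Type _ :=
  Metric.closedBall (0 : Input U) 1

/-! ### Mild solutions

A semilinear system is given by a semigroup `T` and a family `F : I → ℝ → X → X` of
time-dependent nonlinearities indexed by the admissible inputs `i : I`; it stands for
`x'(t) = A x(t) + F i t (x t)`. -/

section Systems

variable {X : Type*} [NormedAddCommGroup X] [NormedSpace ℝ X]

/-- `x` is a mild solution on `[0, τ]` of `x' = A x + g t x`, `x 0 = x₀`, where `A` generates `T`. -/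
structure IsMildSolution (T : C0Semigroup X) (g : ℝ → X → X) (x₀ : X) (τ : ℝ) (x : ℝ → X) :
    Prop where
  continuousOn : ContinuousOn x (Icc 0 τ)
  integrable : ∀ t ∈ Icc 0 τ,
    IntervalIntegrable (fun s => T (t - s) (g s (x s))) volume 0 t
  eq : ∀ t ∈ Icc 0 τ, x t = T t x₀ + ∫ s in (0 : ℝ)..t, T (t - s) (g s (x s))

/-- For every initial state and every input there is a mild solution on some interval `[0, τ]`
with `τ > 0`, and two mild solutions on the same interval coincide. -/
def WellPosed (T : C0Semigroup X) {I : Type*} (F : I → ℝ → X → X) : Prop :=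
  ∀ (x₀ : X) (i : I),
    (∃ τ : ℝ, 0 < τ ∧ ∃ x : ℝ → X, IsMildSolution T (F i) x₀ τ x) ∧
    ∀ (τ : ℝ) (x y : ℝ → X), IsMildSolution T (F i) x₀ τ x → IsMildSolution T (F i) x₀ τ y →
      EqOn x y (Icc 0 τ)

open Classical in
/-- The transition map `φ(t, x₀, i)`: the value at time `t` of the mild solution on `[0, t]`
(and `0` where there is no mild solution on `[0, t]`). -/
def flow (T : C0Semigroup X) {I : Type*} (F : I → ℝ → X → X) (t : ℝ) (x₀ : X) (i : I) : X :=
  if h : ∃ x : ℝ → X, IsMildSolution T (F i) x₀ t x then h.choose t else 0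

/-- Forward completeness: `φ(t, x₀, i)` is defined for all `t ≥ 0`, all `x₀` and all `i`. -/
def ForwardComplete (T : C0Semigroup X) {I : Type*} (F : I → ℝ → X → X) : Prop :=
  ∀ (x₀ : X) (i : I) (t : ℝ), 0 ≤ t → ∃ x : ℝ → X, IsMildSolution T (F i) x₀ t x

/-- Forward completeness with bounded reachability sets. -/
def BRS (T : C0Semigroup X) {I : Type*} [Norm I] (F : I → ℝ → X → X) : Prop :=
  ForwardComplete T F ∧
    ∀ C : ℝ, 0 < C → ∀ τ : ℝ, 0 ≤ τ → ∃ M : ℝ, ∀ (x₀ : X) (i : I) (t : ℝ),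
      ‖x₀‖ < C → ‖i‖ < C → 0 ≤ t → t < τ → ‖flow T F t x₀ i‖ ≤ M

/-- Robust forward completeness with respect to all inputs in the index set `I`. -/
def RobustlyForwardComplete (T : C0Semigroup X) {I : Type*} (F : I → ℝ → X → X) : Prop :=
  ForwardComplete T F ∧
    ∀ C : ℝ, 0 < C → ∀ τ : ℝ, 0 ≤ τ → ∃ M : ℝ, ∀ (x₀ : X) (i : I) (t : ℝ),
      ‖x₀‖ < C → 0 ≤ t → t < τ → ‖flow T F t x₀ i‖ ≤ M

variable {U : Type*} [NormedAddCommGroup U]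

/-- The right-hand side of `x'(t) = A x(t) + f (x t, u t)` with inputs `u ∈ L^∞(ℝ₊, U)`. -/
def openLoop (f : X → U → X) (u : Input U) (t : ℝ) (x : X) : X :=
  f x (u t)

/-- The right-hand side of the closed-loop system
`x'(t) = A x(t) + f (x t, η(‖x t‖) d t)` with `d` in the closed unit ball of `L^∞(ℝ₊, U)`. -/
def closedLoop [NormedSpace ℝ U] (f : X → U → X) (η : ℝ≥0 → ℝ≥0)
    (d : Disturbance U) (t : ℝ) (x : X) : X :=
  f x ((η ‖x‖₊ : ℝ) • (d : Input U) t)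

/-- The set of inputs which are trajectory-dominated with respect to the initial state `x₀` and
the growth margin `η`. -/
def trajectoryDominated (T : C0Semigroup X) (f : X → U → X) (η : ℝ≥0 → ℝ≥0) (x₀ : X) :
    Set (Input U) :=
  {v | ∀ᵐ θ ∂((volume : Measure ℝ).restrict (Ici 0)),
    ‖v θ‖₊ ≤ η ‖flow T (openLoop f) θ x₀ v‖₊}

/-- Robust forward completeness with respect to trajectory-dominated inputs, with growth
margin `η`. -/
def RFCTrajectoryDominatedWith (T : C0Semigroup X) (f : X → U → X) (η : ℝ≥0 → ℝ≥0) : Prop :=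
  ForwardComplete T (openLoop f) ∧
    ∀ C : ℝ, 0 < C → ∀ τ : ℝ, 0 ≤ τ → ∃ M : ℝ, ∀ (x₀ : X), ∀ u ∈ trajectoryDominated T f η x₀,
      ∀ t : ℝ, ‖x₀‖ < C → 0 ≤ t → t < τ → ‖flow T (openLoop f) t x₀ u‖ ≤ M

/-- Robust forward completeness with respect to trajectory-dominated inputs. -/
def RFCTrajectoryDominated (T : C0Semigroup X) (f : X → U → X) : Prop :=
  ∃ η : ℝ≥0 → ℝ≥0, ClassKInfty η ∧ RFCTrajectoryDominatedWith T f η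

/-- The substitution of a continuous path and an admissible input into `f` is strongly measurable
in time. -/
def SubstitutionMeasurable (f : X → U → X) : Prop :=
  ∀ (x : ℝ → X) (u : Input U), Continuous x →
    AEStronglyMeasurable (fun s => f (x s) (u s)) ((volume : Measure ℝ).restrict (Ici 0))

/-- `x ↦ f (x, η(‖x‖) d)` is Lipschitz continuous on bounded sets, uniformly in `d` in the closed
unit ball of `U`. -/
def ClosedLoopLipschitz [NormedSpace ℝ U] (f : X → U → X) (η : ℝ≥0 → ℝ≥0) : Prop :=
  ∀ C : ℝ, 0 < C → ∃ L : ℝ, 0 < L ∧ ∀ (x₁ x₂ : X) (d : U), ‖x₁‖ < C → ‖x₂‖ < C → ‖d‖ ≤ 1 →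
    ‖f x₁ ((η ‖x₁‖₊ : ℝ) • d) - f x₂ ((η ‖x₂‖₊ : ℝ) • d)‖ ≤ L * ‖x₁ - x₂‖

end Systems

end SemilinearEvolution

end

/-!
A bounded input is dominated by the trajectory as long as the trajectory stays outside a large ball,
and trajectory-dominated inputs are the same as feedbacks `η(‖x‖) d` with `d` in the unit ball. The
implications between the three properties exploit this dictionary.

* From the closed loop to trajectory-dominated inputs
  (`RobustlyForwardComplete.rfcTrajectoryDominatedWith`): a dominated input `u` is the feedback of
  the disturbance `u / η(‖x‖)`.
* From trajectory-dominated inputs to bounded reachability sets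
  (`RFCTrajectoryDominatedWith.brs`): let `‖u‖ < C ≤ η(K)`. After the last time at which the
  trajectory is in the ball of radius `max C K`, the shifted input, cut off at the final time, is
  trajectory-dominated, and the trajectory starts in that ball.
* The closed loop for the margin `η` of the standing assumption
  (`RFCTrajectoryDominatedWith.closedLoop_robustlyForwardComplete`): composing the right-hand side
  with the radial retraction onto a ball of radius `R` makes it globally Lipschitz, so that Picard
  iteration on `C([0, τ], X)` gives a unique global solution
  (`IsLipschitzField.exists_isMildSolution`, `IsLipschitzField.eqOn_of_isMildSolution`). As long as
  it stays in the ball it solves the closed-loop system, hence it is an open-loop trajectory with a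
  dominated input and obeys an a priori bound independent of `R`. For `R` above this bound the
  solution never reaches the sphere of radius `R`. In this way neither concatenation of solutions
  nor a blow-up alternative is needed.

Picard iteration rests on the joint continuity of `(t, x) ↦ T t x`, which follows from the
uniform boundedness principle (`C0Semigroup.continuous_max`).
-/

namespace SemilinearEvolution

/-! ### Strong continuity of semigroups -/

section Semigroup

variable {X : Type*} [NormedAddCommGroup X] [NormedSpace ℝ X]

namespace C0Semigroup

theorem tendsto_zero_Ici (T : C0Semigroup X) (x : X) :
    Tendsto (fun t : ℝ => T t x) (𝓝[≥] 0) (𝓝 x) := by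
  have h0 : T 0 x = x := by simp [T.map_zero]
  have h : ContinuousWithinAt (fun t : ℝ => T t x) (Ioi 0) 0 := by
    simpa [ContinuousWithinAt, h0] using T.tendsto_zero x
  have h' := continuousWithinAt_Ioi_iff_Ici.1 h
  simpa [ContinuousWithinAt, h0] using h'

theorem exists_norm_le_near_zero [CompleteSpace X] (T : C0Semigroup X) :
    ∃ δ : ℝ, 0 < δ ∧ ∃ M : ℝ, ∀ t ∈ Icc 0 δ, ‖T t‖ ≤ M := by
  by_contra! hcon
  have h1 : ∀ n : ℕ, ∃ t ∈ Icc (0 : ℝ) (1 / ((n : ℝ) + 1)), (n : ℝ) < ‖T t‖ := fun n =>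
    hcon _ Nat.one_div_pos_of_nat _
  choose t ht hlt using h1
  have htend : Tendsto t atTop (𝓝[≥] 0) := by
    refine tendsto_nhdsWithin_iff.2 ⟨?_, Eventually.of_forall fun n => (ht n).1⟩
    exact squeeze_zero (fun n => (ht n).1) (fun n => (ht n).2)
      tendsto_one_div_add_atTop_nhds_zero_nat
  obtain ⟨C, hC⟩ := banach_steinhaus (g := fun n : ℕ => T (t n)) (fun x => by
    obtain ⟨C, hC⟩ := (((T.tendsto_zero_Ici x).comp htend).norm).bddAbove_range
    exact ⟨C, fun n => hC ⟨n, rfl⟩⟩)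
  obtain ⟨n, hn⟩ := exists_nat_gt C
  exact absurd (hC n) (not_le.2 (hn.trans (hlt n)))

theorem exists_norm_le [CompleteSpace X] (T : C0Semigroup X) (τ : ℝ) :
    ∃ M : ℝ, 0 ≤ M ∧ ∀ t ∈ Icc 0 τ, ‖T t‖ ≤ M := by
  obtain ⟨δ, hδ, M, hM⟩ := T.exists_norm_le_near_zero
  have hM0 : 0 ≤ M := (norm_nonneg _).trans (hM 0 ⟨le_rfl, hδ.le⟩)
  have key : ∀ n : ℕ, ∃ N : ℝ, 0 ≤ N ∧ ∀ t ∈ Icc 0 ((n : ℝ) * δ), ‖T t‖ ≤ N := by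
    intro n
    induction n with
    | zero =>
      refine ⟨M, hM0, fun t ht => hM t ⟨ht.1, ht.2.trans ?_⟩⟩
      simpa using hδ.le
    | succ n ih =>
      obtain ⟨N, hN0, hN⟩ := ih
      refine ⟨max M (M * N), hM0.trans (le_max_left _ _), fun t ht => ?_⟩
      rcases le_total t δ with h | h
      · exact (hM t ⟨ht.1, h⟩).trans (le_max_left _ _)
      · have h2 : t - δ ≤ n * δ := by
          have := ht.2
          push_cast at this
          linarith
        have e : T t = (T δ).comp (T (t - δ)) := by
          rw [← T.map_add δ (t - δ) hδ.le (sub_nonneg.2 h), add_sub_cancel]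
        rw [e]
        refine (ContinuousLinearMap.opNorm_comp_le _ _).trans (le_trans ?_ (le_max_right _ _))
        exact mul_le_mul (hM δ ⟨hδ.le, le_rfl⟩) (hN _ ⟨sub_nonneg.2 h, h2⟩) (norm_nonneg _) hM0
  obtain ⟨n, hn⟩ := exists_nat_gt (τ / δ)
  obtain ⟨N, hN0, hN⟩ := key n
  exact ⟨N, hN0, fun t ht => hN t ⟨ht.1, ht.2.trans ((div_lt_iff₀ hδ).1 hn).le⟩⟩

theorem continuousOn_apply [CompleteSpace X] (T : C0Semigroup X) (x : X) :
    ContinuousOn (fun t : ℝ => T t x) (Ici 0) := by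
  intro a ha
  obtain ⟨M, hM0, hM⟩ := T.exists_norm_le (a + 1)
  have hlim : Tendsto (fun s : ℝ => M * ‖T |s - a| x - x‖) (𝓝[Ici 0] a) (𝓝 0) := by
    have h1 : Tendsto (fun s : ℝ => |s - a|) (𝓝[Ici 0] a) (𝓝[≥] 0) := by
      refine tendsto_nhdsWithin_iff.2 ⟨?_, Eventually.of_forall fun s => mem_Ici.2 (abs_nonneg _)⟩
      have : Continuous fun s : ℝ => |s - a| := by fun_prop
      simpa using (this.tendsto a).mono_left nhdsWithin_le_nhds
    have h2 := ((T.tendsto_zero_Ici x).comp h1).sub_const x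
    simpa using (h2.norm).const_mul M
  rw [ContinuousWithinAt, tendsto_iff_norm_sub_tendsto_zero]
  refine squeeze_zero' (Eventually.of_forall fun s => norm_nonneg _) ?_ hlim
  have hev : ∀ᶠ s in 𝓝[Ici 0] a, s < a + 1 :=
    nhdsWithin_le_nhds (Iio_mem_nhds (lt_add_one a))
  filter_upwards [hev, self_mem_nhdsWithin] with s hs hs0
  have ha' : 0 ≤ a := ha
  have hs0' : 0 ≤ s := hs0
  rcases le_total a s with h | h
  · have e : T s x - T a x = T a (T (s - a) x - x) := by
      have := T.map_add a (s - a) ha' (sub_nonneg.2 h)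
      rw [add_sub_cancel] at this
      simp [this]
    rw [e, abs_of_nonneg (sub_nonneg.2 h)]
    exact (T a).le_of_opNorm_le (hM a ⟨ha', by linarith⟩) _
  · have e : T s x - T a x = -T s (T (a - s) x - x) := by
      have := T.map_add s (a - s) hs0' (sub_nonneg.2 h)
      rw [add_sub_cancel] at this
      simp [this]
    rw [e, norm_neg, abs_sub_comm, abs_of_nonneg (sub_nonneg.2 h)]
    exact (T s).le_of_opNorm_le (hM s ⟨hs0', by linarith⟩) _

/-- Joint continuity of `(t, x) ↦ T t x` for `t ≥ 0`, extended by `x` to negative times. -/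
theorem continuous_max [CompleteSpace X] (T : C0Semigroup X) :
    Continuous fun p : ℝ × X => T (max p.1 0) p.2 := by
  have hs : ∀ x : X, Continuous fun t : ℝ => T (max t 0) x := fun x =>
    (T.continuousOn_apply x).comp_continuous (by fun_prop) fun t => mem_Ici.2 (le_max_right _ _)
  refine continuous_iff_continuousAt.2 fun ⟨a, x⟩ => ?_
  obtain ⟨M, hM0, hM⟩ := T.exists_norm_le (max (a + 1) 0)
  rw [ContinuousAt, tendsto_iff_norm_sub_tendsto_zero]
  have hlim : Tendsto (fun p : ℝ × X => M * ‖p.2 - x‖ + ‖T (max p.1 0) x - T (max a 0) x‖)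
      (𝓝 (a, x)) (𝓝 0) := by
    have hc : Continuous fun p : ℝ × X =>
        M * ‖p.2 - x‖ + ‖T (max p.1 0) x - T (max a 0) x‖ := by
      have := (hs x).comp (continuous_fst (X := ℝ) (Y := X))
      simp only [Function.comp_def] at this
      fun_prop
    simpa using hc.tendsto (a, x)
  refine squeeze_zero' (Eventually.of_forall fun s => norm_nonneg _) ?_ hlim
  have hev : ∀ᶠ p : ℝ × X in 𝓝 (a, x), p.1 < a + 1 :=
    (continuous_fst.tendsto (a, x)).eventually (Iio_mem_nhds (lt_add_one a))
  filter_upwards [hev] with p hp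
  have e : T (max p.1 0) p.2 - T (max a 0) x
      = T (max p.1 0) (p.2 - x) + (T (max p.1 0) x - T (max a 0) x) := by
    simp
  rw [e]
  refine (norm_add_le _ _).trans (add_le_add_left ?_ _)
  exact (T _).le_of_opNorm_le (hM _ ⟨le_max_right _ _, max_le_max_right _ hp.le⟩) _

theorem aestronglyMeasurable_conv [CompleteSpace X] (T : C0Semigroup X) {μ : Measure ℝ}
    {h : ℝ → X} (hh : AEStronglyMeasurable h μ) (t : ℝ) :
    AEStronglyMeasurable (fun s => T (max (t - s) 0) (h s)) μ :=
  T.continuous_max.comp_aestronglyMeasurable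
    ((by fun_prop : Continuous fun s : ℝ => t - s).aestronglyMeasurable.prodMk hh)

/-! ### The convolution of a semigroup with a bounded function -/

section Convolution

variable [CompleteSpace X] (T : C0Semigroup X) {h : ℝ → X} {B τ : ℝ}

theorem intervalIntegrable_conv
    (hh : AEStronglyMeasurable h ((volume : Measure ℝ).restrict (Ici 0)))
    (hB : ∀ᵐ s ∂((volume : Measure ℝ).restrict (Ici 0)), ‖h s‖ ≤ B) {t : ℝ} (ht : 0 ≤ t) :
    IntervalIntegrable (fun s => T (t - s) (h s)) volume 0 t := by
  obtain ⟨M, hM0, hM⟩ := T.exists_norm_le t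
  have hsub : Ioc 0 t ⊆ Ici (0 : ℝ) := fun s hs => hs.1.le
  have hle : (volume : Measure ℝ).restrict (Ioc 0 t) ≤ volume.restrict (Ici 0) :=
    Measure.restrict_mono hsub le_rfl
  rw [intervalIntegrable_iff_integrableOn_Ioc_of_le ht]
  have heq : (fun s => T (max (t - s) 0) (h s)) =ᵐ[volume.restrict (Ioc 0 t)]
      fun s => T (t - s) (h s) := by
    filter_upwards [ae_restrict_mem measurableSet_Ioc] with s hs
    rw [max_eq_left (sub_nonneg.2 hs.2)]
  refine Integrable.of_bound (((T.aestronglyMeasurable_conv hh t).mono_measure hle).congr heq)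
    (M * B) ?_
  filter_upwards [ae_restrict_mem measurableSet_Ioc, ae_mono hle hB] with s hs hb
  refine ((T (t - s)).le_of_opNorm_le
    (hM _ ⟨sub_nonneg.2 hs.2, by linarith [hs.1]⟩) _).trans ?_
  exact mul_le_mul_of_nonneg_left hb hM0

theorem continuousOn_conv
    (hh : AEStronglyMeasurable h ((volume : Measure ℝ).restrict (Ici 0)))
    (hB : ∀ᵐ s ∂((volume : Measure ℝ).restrict (Ici 0)), ‖h s‖ ≤ B) :
    ContinuousOn (fun t => ∫ s in (0 : ℝ)..t, T (t - s) (h s)) (Icc 0 τ) := by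
  obtain ⟨M, hM0, hM⟩ := T.exists_norm_le τ
  have hle : (volume : Measure ℝ).restrict (Ioc 0 τ) ≤ volume.restrict (Ici 0) :=
    Measure.restrict_mono (fun s hs => hs.1.le) le_rfl
  -- the integrals over `[0, t]` become integrals over the fixed interval `(0, τ]`
  let F : ℝ → ℝ → X := fun t s => (Iic t).indicator (fun s => T (max (t - s) 0) (h s)) s
  have hF : ∀ t ∈ Icc 0 τ, ∫ s in (0 : ℝ)..t, T (t - s) (h s) = ∫ s in Ioc 0 τ, F t s := by
    intro t ht
    rw [intervalIntegral.integral_of_le ht.1, setIntegral_indicator measurableSet_Iic,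
      Ioc_inter_Iic, min_eq_right ht.2]
    refine setIntegral_congr_fun measurableSet_Ioc fun s hs => ?_
    simp only [max_eq_left (sub_nonneg.2 hs.2)]
  refine ContinuousOn.congr (f := fun t => ∫ s in Ioc 0 τ, F t s) ?_ hF
  intro t₀ ht₀
  refine continuousWithinAt_of_dominated (bound := fun _ => M * |B|) ?_ ?_ (integrable_const _) ?_
  · exact Eventually.of_forall fun t =>
      ((T.aestronglyMeasurable_conv hh t).mono_measure hle).indicator measurableSet_Iic
  · filter_upwards [self_mem_nhdsWithin] with t ht
    filter_upwards [ae_restrict_mem measurableSet_Ioc, ae_mono hle hB] with s hs hb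
    have h1 : ‖T (max (t - s) 0) (h s)‖ ≤ M * |B| := by
      refine ((T _).le_of_opNorm_le (hM _ ⟨le_max_right _ _, ?_⟩) _).trans
        (mul_le_mul_of_nonneg_left (hb.trans (le_abs_self B)) hM0)
      exact max_le (by linarith [hs.1, ht.2]) (ht.1.trans ht.2)
    exact (norm_indicator_le_norm_self _ _).trans h1
  · filter_upwards [Measure.ae_ne _ t₀] with s hs
    refine ContinuousAt.continuousWithinAt ?_
    rcases lt_or_gt_of_ne hs with hlt | hlt
    · have hc : Continuous fun t => T (max (t - s) 0) (h s) :=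
        T.continuous_max.comp (by fun_prop : Continuous fun t : ℝ => (t - s, h s))
      refine hc.continuousAt.congr ?_
      filter_upwards [Ioi_mem_nhds hlt] with t ht
      exact (indicator_of_mem (mem_Iic.2 (le_of_lt ht)) (fun s => T (max (t - s) 0) (h s))).symm
    · refine (continuousAt_const (y := (0 : X))).congr ?_
      filter_upwards [Iio_mem_nhds hlt] with t ht
      exact (indicator_of_notMem (notMem_Iic.2 ht)
        (fun s => T (max (t - s) 0) (h s))).symm

end Convolution

end C0Semigroup

end Semigroup

/-! ### Globally Lipschitz nonlinearities -/

section Picard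

variable {X : Type*} [NormedAddCommGroup X]

/-- A time-dependent nonlinearity which is measurable along continuous paths, Lipschitz in the state
with a constant independent of time, and bounded at the origin. -/
structure IsLipschitzField (g : ℝ → X → X) (L B : ℝ) : Prop where
  measurable : ∀ x : ℝ → X, Continuous x →
    AEStronglyMeasurable (fun s => g s (x s)) ((volume : Measure ℝ).restrict (Ici 0))
  lipschitz : ∀ᵐ s ∂((volume : Measure ℝ).restrict (Ici 0)), ∀ x y : X,
    ‖g s x - g s y‖ ≤ L * ‖x - y‖
  bound : ∀ᵐ s ∂((volume : Measure ℝ).restrict (Ici 0)), ‖g s 0‖ ≤ B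
  nonneg : 0 ≤ L

namespace IsLipschitzField

variable {g : ℝ → X → X} {L B : ℝ}

theorem norm_comp_le (hg : IsLipschitzField g L B) {x : ℝ → X} {R : ℝ} (hx : ∀ s, ‖x s‖ ≤ R) :
    ∀ᵐ s ∂((volume : Measure ℝ).restrict (Ici 0)), ‖g s (x s)‖ ≤ L * R + B := by
  filter_upwards [hg.lipschitz, hg.bound] with s h1 h2
  have h3 := h1 (x s) 0
  rw [sub_zero] at h3
  have h4 : ‖g s (x s)‖ ≤ ‖g s (x s) - g s 0‖ + ‖g s 0‖ := norm_le_norm_sub_add _ _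
  linarith [mul_le_mul_of_nonneg_left (hx s) hg.nonneg]

variable [NormedSpace ℝ X] [CompleteSpace X]

/-- The Picard operator on `C([0, τ], X)`; paths are extended to the whole line by constants. -/
theorem exists_picardMap (T : C0Semigroup X) (hg : IsLipschitzField g L B) (x₀ : X) {τ : ℝ}
    (hτ : 0 ≤ τ) :
    ∃ Φ : C(Icc (0 : ℝ) τ, X) → C(Icc (0 : ℝ) τ, X), ∀ x t,
      Φ x t = T t x₀ + ∫ s in (0 : ℝ)..t, T (t - s) (g s (IccExtend hτ x s)) := by
  have hc : ∀ x : C(Icc (0 : ℝ) τ, X), ContinuousOn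
      (fun t => T t x₀ + ∫ s in (0 : ℝ)..t, T (t - s) (g s (IccExtend hτ x s))) (Icc 0 τ) := by
    intro x
    refine ((T.continuousOn_apply x₀).mono fun t ht => ht.1).add ?_
    refine T.continuousOn_conv (hg.measurable _ x.continuous.Icc_extend')
      (hg.norm_comp_le (R := ‖x‖) fun s => ?_)
    exact x.norm_coe_le_norm _
  exact ⟨fun x => ⟨_, (hc x).domRestrict⟩, fun x t => rfl⟩

theorem isMildSolution_of_isFixedPt (T : C0Semigroup X) (hg : IsLipschitzField g L B) (x₀ : X)
    {τ : ℝ} (hτ : 0 ≤ τ) {x : C(Icc (0 : ℝ) τ, X)}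
    (hx : ∀ t : Icc (0 : ℝ) τ,
      x t = T t x₀ + ∫ s in (0 : ℝ)..t, T (t - s) (g s (IccExtend hτ x s))) :
    IsMildSolution T g x₀ τ (IccExtend hτ x) where
  continuousOn := x.continuous.Icc_extend'.continuousOn
  integrable t ht := T.intervalIntegrable_conv (hg.measurable _ x.continuous.Icc_extend')
    (hg.norm_comp_le (R := ‖x‖) fun s => x.norm_coe_le_norm _) ht.1
  eq t ht := by rw [IccExtend_of_mem hτ x ht]; exact hx ⟨t, ht⟩

/-- The differences of Picard iterates decay like the terms of an exponential series, so some
iterate is a contraction. -/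
theorem picardMap_iterate_sub_le (T : C0Semigroup X) (hg : IsLipschitzField g L B) {x₀ : X} {τ : ℝ}
    (hτ : 0 ≤ τ) {Φ : C(Icc (0 : ℝ) τ, X) → C(Icc (0 : ℝ) τ, X)}
    (hΦ : ∀ x t, Φ x t = T t x₀ + ∫ s in (0 : ℝ)..t, T (t - s) (g s (IccExtend hτ x s)))
    {M : ℝ} (hM0 : 0 ≤ M) (hM : ∀ t ∈ Icc 0 τ, ‖T t‖ ≤ M) (x y : C(Icc (0 : ℝ) τ, X)) (n : ℕ) :
    ∀ t : Icc (0 : ℝ) τ, ‖Φ^[n] x t - Φ^[n] y t‖ ≤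
      (M * L * t) ^ n / (n.factorial : ℝ) * dist x y := by
  induction n with
  | zero =>
    intro t
    simpa [dist_eq_norm] using (x - y).norm_coe_le_norm t
  | succ n ih =>
    intro t
    rw [Function.iterate_succ_apply', Function.iterate_succ_apply']
    set p := Φ^[n] x
    set q := Φ^[n] y
    have hint : ∀ z : C(Icc (0 : ℝ) τ, X),
        IntervalIntegrable (fun s => T (t - s) (g s (IccExtend hτ z s))) volume 0 t := fun z =>
      T.intervalIntegrable_conv (hg.measurable _ z.continuous.Icc_extend')
        (hg.norm_comp_le (R := ‖z‖) fun s => z.norm_coe_le_norm _) t.2.1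
    rw [hΦ, hΦ, add_sub_add_left_eq_sub, ← intervalIntegral.integral_sub (hint p) (hint q)]
    have hae : ∀ᵐ s, s ∈ Ioc 0 (t : ℝ) →
        ‖T (t - s) (g s (IccExtend hτ p s)) - T (t - s) (g s (IccExtend hτ q s))‖ ≤
          (M * L) ^ (n + 1) / (n.factorial : ℝ) * dist x y * s ^ n := by
      have h1 := (ae_restrict_iff' measurableSet_Ici).1 hg.lipschitz
      filter_upwards [h1] with s hs hst
      have hs' : s ∈ Icc 0 τ := ⟨hst.1.le, hst.2.trans t.2.2⟩
      rw [← map_sub]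
      refine ((T (t - s)).le_of_opNorm_le (hM _ ⟨sub_nonneg.2 hst.2, ?_⟩) _).trans ?_
      · linarith [t.2.2, hst.1]
      refine (mul_le_mul_of_nonneg_left (hs hst.1.le _ _) hM0).trans ?_
      rw [IccExtend_of_mem hτ p hs', IccExtend_of_mem hτ q hs']
      refine (mul_le_mul_of_nonneg_left
        (mul_le_mul_of_nonneg_left (ih ⟨s, hs'⟩) hg.nonneg) hM0).trans (le_of_eq ?_)
      simp only [mul_pow]
      ring
    refine (intervalIntegral.norm_integral_le_of_norm_le t.2.1 hae
      (Continuous.intervalIntegrable (by fun_prop) _ _)).trans (le_of_eq ?_)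
    rw [intervalIntegral.integral_const_mul, integral_pow, Nat.factorial_succ]
    push_cast
    have : (n.factorial : ℝ) ≠ 0 := by positivity
    have : (n : ℝ) + 1 ≠ 0 := by positivity
    field_simp
    ring

theorem exists_contractingWith_iterate (T : C0Semigroup X) (hg : IsLipschitzField g L B) {x₀ : X}
    {τ : ℝ} (hτ : 0 ≤ τ) {Φ : C(Icc (0 : ℝ) τ, X) → C(Icc (0 : ℝ) τ, X)}
    (hΦ : ∀ x t, Φ x t = T t x₀ + ∫ s in (0 : ℝ)..t, T (t - s) (g s (IccExtend hτ x s))) :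
    ∃ (n : ℕ) (K : ℝ≥0), ContractingWith K Φ^[n] := by
  obtain ⟨M, hM0, hM⟩ := T.exists_norm_le τ
  obtain ⟨n, hn⟩ := ((FloorSemiring.tendsto_pow_div_factorial_atTop (M * L * τ)).eventually
    (gt_mem_nhds one_pos)).exists
  have hML : 0 ≤ M * L * τ := mul_nonneg (mul_nonneg hM0 hg.nonneg) hτ
  have hK : 0 ≤ (M * L * τ) ^ n / (n.factorial : ℝ) := by positivity
  refine ⟨n, ⟨_, hK⟩, ?_, LipschitzWith.of_dist_le_mul fun x y => ?_⟩
  · exact_mod_cast hn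
  refine (ContinuousMap.dist_le (mul_nonneg hK dist_nonneg)).2 fun t => ?_
  rw [dist_eq_norm]
  refine (picardMap_iterate_sub_le T hg hτ hΦ hM0 hM x y n t).trans ?_
  refine mul_le_mul_of_nonneg_right ?_ dist_nonneg
  have h1 : 0 ≤ M * L * t := mul_nonneg (mul_nonneg hM0 hg.nonneg) t.2.1
  have h2 : M * L * t ≤ M * L * τ := mul_le_mul_of_nonneg_left t.2.2 (mul_nonneg hM0 hg.nonneg)
  exact div_le_div_of_nonneg_right (pow_le_pow_left₀ h1 h2 n) (by positivity)

theorem exists_isMildSolution (T : C0Semigroup X) (hg : IsLipschitzField g L B) (x₀ : X) {τ : ℝ}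
    (hτ : 0 ≤ τ) : ∃ x : ℝ → X, IsMildSolution T g x₀ τ x := by
  obtain ⟨Φ, hΦ⟩ := exists_picardMap T hg x₀ hτ
  obtain ⟨n, K, hK⟩ := exists_contractingWith_iterate T hg hτ hΦ
  have hfix := hK.isFixedPt_fixedPoint_iterate
  exact ⟨_, isMildSolution_of_isFixedPt T hg x₀ hτ
    (x := ContractingWith.fixedPoint Φ^[n] hK) fun t => by rw [← hΦ, hfix.eq]⟩

theorem eqOn_of_isMildSolution (T : C0Semigroup X) (hg : IsLipschitzField g L B) {x₀ : X} {τ : ℝ}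
    {x y : ℝ → X} (hx : IsMildSolution T g x₀ τ x) (hy : IsMildSolution T g x₀ τ y) :
    EqOn x y (Icc 0 τ) := by
  rcases lt_or_ge τ 0 with hneg | hτ
  · simp [Icc_eq_empty (not_le.2 hneg)]
  obtain ⟨Φ, hΦ⟩ := exists_picardMap T hg x₀ hτ
  obtain ⟨n, K, hK⟩ := exists_contractingWith_iterate T hg hτ hΦ
  have hfix : ∀ z (hz : IsMildSolution T g x₀ τ z),
      Function.IsFixedPt Φ ⟨_, hz.continuousOn.domRestrict⟩ := by
    intro z hz
    refine ContinuousMap.ext fun t => ?_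
    rw [hΦ]
    refine Eq.trans ?_ (hz.eq t t.2).symm
    congr 1
    refine intervalIntegral.integral_congr fun s hs => ?_
    rw [uIcc_of_le t.2.1] at hs
    have hs' : s ∈ Icc 0 τ := ⟨hs.1, hs.2.trans t.2.2⟩
    simp only [IccExtend_of_mem hτ _ hs', ContinuousMap.coe_mk, domRestrict_apply]
  have hxy := hK.fixedPoint_unique' ((hfix x hx).iterate n) ((hfix y hy).iterate n)
  intro t ht
  exact DFunLike.congr_fun hxy ⟨t, ht⟩

end IsLipschitzField

end Picard

/-! ### Restricting, modifying and shifting mild solutions -/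

section Mild

variable {X : Type*} [NormedAddCommGroup X] [NormedSpace ℝ X] {T : C0Semigroup X}

namespace IsMildSolution

variable {g g' : ℝ → X → X} {x₀ : X} {τ : ℝ} {x : ℝ → X}

theorem apply_zero (hx : IsMildSolution T g x₀ τ x) (hτ : 0 ≤ τ) : x 0 = x₀ := by
  have h := hx.eq 0 ⟨le_rfl, hτ⟩
  simpa [T.map_zero] using h

theorem mono (hx : IsMildSolution T g x₀ τ x) {t : ℝ} (ht : t ≤ τ) :
    IsMildSolution T g x₀ t x where
  continuousOn := hx.continuousOn.mono (Icc_subset_Icc_right ht)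
  integrable s hs := hx.integrable s ⟨hs.1, hs.2.trans ht⟩
  eq s hs := hx.eq s ⟨hs.1, hs.2.trans ht⟩

/-- A mild solution only depends on the nonlinearity along the path, at almost every time. -/
theorem congr (hx : IsMildSolution T g x₀ τ x)
    (h : ∀ᵐ s ∂(volume : Measure ℝ), s ∈ Icc 0 τ → g s (x s) = g' s (x s)) :
    IsMildSolution T g' x₀ τ x where
  continuousOn := hx.continuousOn
  integrable t ht := by
    refine (hx.integrable t ht).congr_ae ?_
    rw [uIoc_of_le ht.1, EventuallyEq, ae_restrict_iff' measurableSet_Ioc]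
    filter_upwards [h] with s hs hst
    rw [hs ⟨hst.1.le, hst.2.trans ht.2⟩]
  eq t ht := by
    rw [hx.eq t ht]
    congr 1
    refine intervalIntegral.integral_congr_ae ?_
    filter_upwards [h] with s hs hst
    rw [uIoc_of_le ht.1] at hst
    rw [hs ⟨hst.1.le, hst.2.trans ht.2⟩]

theorem shift [CompleteSpace X] (hx : IsMildSolution T g x₀ τ x) {a : ℝ} (ha : a ∈ Icc 0 τ) :
    IsMildSolution T (fun s => g (s + a)) (x a) (τ - a) (fun s => x (s + a)) where
  continuousOn := hx.continuousOn.comp (by fun_prop) fun s hs =>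
    ⟨add_nonneg hs.1 ha.1, by linarith [hs.2]⟩
  integrable t ht := by
    have h1 := hx.integrable (t + a) ⟨add_nonneg ht.1 ha.1, by linarith [ht.2]⟩
    have h2 : IntervalIntegrable (fun s => T (t + a - s) (g s (x s))) volume a (t + a) :=
      h1.mono_set (by
        rw [uIcc_of_le (by linarith [ht.1]), uIcc_of_le (by linarith [ht.1, ha.1])]
        exact Icc_subset_Icc_left ha.1)
    simpa using h2.comp_add_right a
  eq t ht := by
    have hta : t + a ∈ Icc 0 τ := ⟨add_nonneg ht.1 ha.1, by linarith [ht.2]⟩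
    have h1 := hx.integrable (t + a) hta
    have h01 : IntervalIntegrable (fun s => T (t + a - s) (g s (x s))) volume 0 a :=
      h1.mono_set (by
        rw [uIcc_of_le ha.1, uIcc_of_le hta.1]
        exact Icc_subset_Icc_right (by linarith [ht.1]))
    have h02 : IntervalIntegrable (fun s => T (t + a - s) (g s (x s))) volume a (t + a) :=
      h1.mono_set (by
        rw [uIcc_of_le (by linarith [ht.1]), uIcc_of_le hta.1]
        exact Icc_subset_Icc_left ha.1)
    have e1 : ∫ s in (0 : ℝ)..t, T (t - s) (g (s + a) (x (s + a)))
        = ∫ s in a..(t + a), T (t + a - s) (g s (x s)) := by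
      have := intervalIntegral.integral_comp_add_right (a := 0) (b := t)
        (fun s => T (t + a - s) (g s (x s))) a
      simpa using this
    have e2 : T t (∫ s in (0 : ℝ)..a, T (a - s) (g s (x s)))
        = ∫ s in (0 : ℝ)..a, T (t + a - s) (g s (x s)) := by
      rw [← ContinuousLinearMap.intervalIntegral_comp_comm _ (hx.integrable a ha)]
      refine intervalIntegral.integral_congr fun s hs => ?_
      rw [uIcc_of_le ha.1] at hs
      have := T.map_add t (a - s) ht.1 (sub_nonneg.2 hs.2)
      simp [add_sub_assoc, this]
    rw [hx.eq (t + a) hta, hx.eq a ha, map_add, e1, e2, T.map_add t a ht.1 ha.1,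
      ← intervalIntegral.integral_add_adjacent_intervals h01 h02, add_assoc]
    rfl

theorem flow_eq {I : Type*} {F : I → ℝ → X → X} {i : I} (hx : IsMildSolution T (F i) x₀ τ x)
    (huniq : ∀ (τ : ℝ) (x y : ℝ → X), IsMildSolution T (F i) x₀ τ x →
      IsMildSolution T (F i) x₀ τ y → EqOn x y (Icc 0 τ)) {t : ℝ} (ht : t ∈ Icc 0 τ) :
    flow T F t x₀ i = x t := by
  have h : ∃ y : ℝ → X, IsMildSolution T (F i) x₀ t y := ⟨x, hx.mono ht.2⟩
  rw [flow, dif_pos h]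
  exact huniq t _ _ h.choose_spec (hx.mono ht.2) ⟨ht.1, le_rfl⟩

end IsMildSolution

end Mild

/-! ### Trajectory-dominated inputs and bounded reachability sets -/

section OpenLoop

theorem ae_norm_le_norm_input {U : Type*} [NormedAddCommGroup U] (u : Input U) :
    ∀ᵐ s ∂((volume : Measure ℝ).restrict (Ici 0)), ‖u s‖ ≤ ‖u‖ := by
  filter_upwards [ae_le_eLpNormEssSup (f := u) (μ := (volume : Measure ℝ).restrict (Ici 0))]
    with s hs
  rw [← eLpNorm_exponent_top, ← Lp.enorm_def] at hs
  exact enorm_le_iff_norm_le.1 hs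

variable {X : Type*} [NormedAddCommGroup X] [NormedSpace ℝ X] {T : C0Semigroup X}
  {U : Type*} [NormedAddCommGroup U] {f : X → U → X} {η : ℝ≥0 → ℝ≥0}

/-- A path driven by a function `v` with `‖v s‖ ≤ η(‖x s‖)` on `[0, τ]` obeys every bound valid for
trajectory-dominated inputs: cutting `v` off after time `τ` makes it a trajectory-dominated
element of `L^∞(ℝ₊, U)` without changing the path. -/
theorem norm_le_of_dominated (hwp : WellPosed T (openLoop f)) {x₀ : X} {M b : ℝ}
    (hM : ∀ u ∈ trajectoryDominated T f η x₀, ∀ t : ℝ, 0 ≤ t → t < b →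
      ‖flow T (openLoop f) t x₀ u‖ ≤ M)
    {v : ℝ → U} (hv : AEStronglyMeasurable v ((volume : Measure ℝ).restrict (Ici 0)))
    {τ : ℝ} (hτ : 0 ≤ τ) (hτb : τ < b) {x : ℝ → X}
    (hx : IsMildSolution T (fun s y => f y (v s)) x₀ τ x) {K : ℝ}
    (hK : ∀ᵐ s ∂((volume : Measure ℝ).restrict (Ici 0)), s ∈ Icc 0 τ → ‖v s‖ ≤ K)
    (hdom : ∀ᵐ s ∂((volume : Measure ℝ).restrict (Ici 0)), s ∈ Icc 0 τ → ‖v s‖₊ ≤ η ‖x s‖₊) :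
    ‖x τ‖ ≤ M := by
  have hmem : MemLp ((Icc 0 τ).indicator v) ∞ ((volume : Measure ℝ).restrict (Ici 0)) := by
    refine memLp_top_of_bound (hv.indicator measurableSet_Icc) |K| ?_
    filter_upwards [hK] with s hs
    by_cases hsI : s ∈ Icc 0 τ
    · rw [indicator_of_mem hsI]
      exact (hs hsI).trans (le_abs_self K)
    · rw [indicator_of_notMem hsI, norm_zero]
      exact abs_nonneg K
  let u : Input U := hmem.toLp _
  have hu := hmem.coeFn_toLp
  have hxu : IsMildSolution T (openLoop f u) x₀ τ x := by
    refine hx.congr ?_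
    filter_upwards [(ae_restrict_iff' measurableSet_Ici).1 hu] with s hs hsI
    simp only [openLoop]
    rw [hs hsI.1, indicator_of_mem hsI]
  have hfl : ∀ t ∈ Icc 0 τ, flow T (openLoop f) t x₀ u = x t := fun t ht =>
    hxu.flow_eq (hwp x₀ u).2 ht
  have hud : u ∈ trajectoryDominated T f η x₀ := by
    simp only [trajectoryDominated, mem_ofPred_eq]
    filter_upwards [hu, hdom] with s hs hd
    rw [hs]
    by_cases hsI : s ∈ Icc 0 τ
    · rw [indicator_of_mem hsI, hfl s hsI]
      exact hd hsI
    · rw [indicator_of_notMem hsI, nnnorm_zero]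
      exact zero_le
  rw [← hfl τ ⟨hτ, le_rfl⟩]
  exact hM u hud τ hτ hτb

/-- After the last time at which `‖x‖ ≤ η⁻¹(C)`, an input bounded by `C` is dominated by the
trajectory, so a bound for trajectory-dominated inputs started in that ball applies. -/
theorem RFCTrajectoryDominatedWith.brs [CompleteSpace X] (hwp : WellPosed T (openLoop f))
    (hη : ClassKInfty η) (h : RFCTrajectoryDominatedWith T f η) : BRS T (openLoop f) := by
  refine ⟨h.1, fun C hC τ hτ => ?_⟩
  obtain ⟨K, hK⟩ := hη.unbounded C.toNNReal
  set R : ℝ := max C K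
  obtain ⟨M, hM⟩ := h.2 (R + 1) (by positivity) τ hτ
  refine ⟨max R M, fun x₀ u t hx₀ hu ht htτ => ?_⟩
  obtain ⟨x, hx⟩ := h.1 x₀ u t ht
  rw [hx.flow_eq (hwp x₀ u).2 ⟨ht, le_rfl⟩]
  have hcomp : IsCompact (Icc 0 t ∩ x ⁻¹' Metric.closedBall 0 R) :=
    isCompact_Icc.of_isClosed_subset
      (hx.continuousOn.preimage_isClosed_of_isClosed isClosed_Icc Metric.isClosed_closedBall)
      inter_subset_left
  have h0 : (0 : ℝ) ∈ Icc 0 t ∩ x ⁻¹' Metric.closedBall 0 R := by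
    refine ⟨⟨le_rfl, ht⟩, ?_⟩
    rw [mem_preimage, hx.apply_zero ht, mem_closedBall_zero_iff]
    exact hx₀.le.trans (le_max_left C K)
  obtain ⟨a, ⟨haI, haR⟩, hmax⟩ := hcomp.exists_isGreatest ⟨0, h0⟩
  have haR' : ‖x a‖ ≤ R := by simpa using haR
  refine le_trans ?_ (le_max_right R M)
  have hub : ∀ᵐ s ∂(volume : Measure ℝ), s ∈ Ici (0 : ℝ) → ‖u s‖ ≤ C := by
    rw [← ae_restrict_iff' measurableSet_Ici]
    filter_upwards [ae_norm_le_norm_input u] with s hs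
    exact hs.trans hu.le
  have hub' : ∀ᵐ s ∂(volume : Measure ℝ), s + a ∈ Ici (0 : ℝ) → ‖u (s + a)‖ ≤ C :=
    (measurePreserving_add_right volume a).quasiMeasurePreserving.ae hub
  have hmeas : AEStronglyMeasurable (fun s => u (s + a))
      ((volume : Measure ℝ).restrict (Ici 0)) := by
    have hq : MeasurePreserving (fun s : ℝ => s + a)
        (volume.restrict ((fun s : ℝ => s + a) ⁻¹' Ici 0)) (volume.restrict (Ici 0)) :=
      (measurePreserving_add_right volume a).restrict_preimage measurableSet_Ici
    refine ((Lp.aestronglyMeasurable u).comp_measurePreserving hq).mono_measure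
      (Measure.restrict_mono (fun s hs => ?_) le_rfl)
    exact add_nonneg (mem_Ici.1 hs) haI.1
  have key := norm_le_of_dominated (b := τ) (M := M) (η := η) hwp
    (fun w hw r hr hrτ => hM (x a) w hw r (haR'.trans_lt (lt_add_one R)) hr hrτ) hmeas
    (sub_nonneg.2 haI.2) (by linarith [haI.1]) (hx.shift haI) (K := C) ?_ ?_
  · simpa using key
  · rw [ae_restrict_iff' measurableSet_Ici]
    filter_upwards [hub'] with s hs hs0 _
    exact hs (add_nonneg hs0 haI.1)
  · rw [ae_restrict_iff' measurableSet_Ici]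
    -- at time `s = 0` the path may be on the sphere of radius `R`, so this null set is left out
    filter_upwards [hub', Measure.ae_ne volume 0] with s hs hsne hs0 hsI
    have hpos : 0 < s := lt_of_le_of_ne hs0 hsne.symm
    have hR : R < ‖x (s + a)‖ := by
      by_contra! hle
      have : s + a ≤ a := hmax ⟨⟨by linarith [haI.1], by linarith [hsI.2]⟩, by simpa using hle⟩
      linarith
    have h1 : η K ≤ η ‖x (s + a)‖₊ := by
      refine hη.strictMono.monotone ?_
      rw [← NNReal.coe_le_coe, coe_nnnorm]
      exact (le_max_right C K).trans hR.le
    refine le_trans ?_ (hK.le.trans h1)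
    rw [← norm_toNNReal]
    exact Real.toNNReal_le_toNNReal (hs (add_nonneg hs0 haI.1))

end OpenLoop

/-! ### The closed-loop system -/

section ClosedLoop

/-- The radial retraction onto the closed ball of radius `R` around the origin. -/
noncomputable def radialRetraction {X : Type*} [NormedAddCommGroup X] [NormedSpace ℝ X] (R : ℝ)
    (x : X) : X :=
  (R / max R ‖x‖) • x

section Retraction

variable {X : Type*} [NormedAddCommGroup X] [NormedSpace ℝ X] {R : ℝ}

theorem radialRetraction_of_norm_le (hR : 0 < R) {x : X} (hx : ‖x‖ ≤ R) :
    radialRetraction R x = x := by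
  rw [radialRetraction, max_eq_left hx, div_self hR.ne', one_smul]

theorem norm_radialRetraction_le (hR : 0 < R) (x : X) : ‖radialRetraction R x‖ ≤ R := by
  have hm : 0 < max R ‖x‖ := lt_max_of_lt_left hR
  rw [radialRetraction, norm_smul, Real.norm_of_nonneg (by positivity), div_mul_eq_mul_div,
    div_le_iff₀ hm]
  exact mul_le_mul_of_nonneg_left (le_max_right _ _) hR.le

theorem norm_radialRetraction_sub_le (hR : 0 < R) (x y : X) :
    ‖radialRetraction R x - radialRetraction R y‖ ≤ 2 * ‖x - y‖ := by
  have ha : 0 < max R ‖x‖ := lt_max_of_lt_left hR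
  have hb : 0 < max R ‖y‖ := lt_max_of_lt_left hR
  have e : radialRetraction R x - radialRetraction R y
      = (R / max R ‖x‖) • (x - y) + (R / max R ‖x‖ - R / max R ‖y‖) • y := by
    simp only [radialRetraction, smul_sub, sub_smul]
    abel
  have ha1 : R / max R ‖x‖ ≤ 1 := (div_le_one ha).2 (le_max_left _ _)
  have hb1 : ‖y‖ / max R ‖y‖ ≤ 1 := (div_le_one hb).2 (le_max_right _ _)
  have h1 : ‖(R / max R ‖x‖) • (x - y)‖ ≤ ‖x - y‖ := by
    rw [norm_smul, Real.norm_of_nonneg (by positivity)]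
    exact mul_le_of_le_one_left (norm_nonneg _) ha1
  have h2 : ‖(R / max R ‖x‖ - R / max R ‖y‖) • y‖ ≤ ‖x - y‖ := by
    have e2 : R / max R ‖x‖ - R / max R ‖y‖
        = R / max R ‖x‖ * ((max R ‖y‖ - max R ‖x‖) / max R ‖y‖) := by
      field_simp
    have h3 : |max R ‖y‖ - max R ‖x‖| ≤ ‖x - y‖ := by
      refine (abs_max_sub_max_le_max R ‖y‖ R ‖x‖).trans ?_
      rw [sub_self, abs_zero, norm_sub_rev]
      exact max_le (norm_nonneg _) (abs_norm_sub_norm_le _ _)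
    rw [norm_smul, e2, Real.norm_eq_abs, abs_mul, abs_div _ (max R ‖y‖), abs_of_pos hb,
      abs_of_nonneg (by positivity : 0 ≤ R / max R ‖x‖)]
    calc R / max R ‖x‖ * (|max R ‖y‖ - max R ‖x‖| / max R ‖y‖) * ‖y‖
        = R / max R ‖x‖ * (|max R ‖y‖ - max R ‖x‖| * (‖y‖ / max R ‖y‖)) := by ring
      _ ≤ 1 * (‖x - y‖ * 1) := by gcongr
      _ = ‖x - y‖ := by ring
  rw [e]
  exact (norm_add_le _ _).trans (by linarith)

theorem continuous_radialRetraction (hR : 0 < R) :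
    Continuous (radialRetraction R : X → X) :=
  (LipschitzWith.of_dist_le_mul (K := 2) fun x y => by
    simpa [dist_eq_norm] using norm_radialRetraction_sub_le hR x y).continuous

end Retraction

theorem disturbance_ae_norm_le_one {U : Type*} [NormedAddCommGroup U] (d : Disturbance U) :
    ∀ᵐ s ∂((volume : Measure ℝ).restrict (Ici 0)), ‖(d : Input U) s‖ ≤ 1 := by
  filter_upwards [ae_norm_le_norm_input (d : Input U)] with s hs
  exact hs.trans (mem_closedBall_zero_iff.1 d.2)

theorem aestronglyMeasurable_feedback {X U : Type*} [NormedAddCommGroup X]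
    [NormedAddCommGroup U] [NormedSpace ℝ U] {η : ℝ≥0 → ℝ≥0} (hη : Continuous η)
    (d : Disturbance U) {x : ℝ → X} (hx : Continuous x) :
    AEStronglyMeasurable (fun s => (η ‖x s‖₊ : ℝ) • (d : Input U) s)
      ((volume : Measure ℝ).restrict (Ici 0)) :=
  (Continuous.aestronglyMeasurable (by fun_prop)).smul (Lp.aestronglyMeasurable _)

variable {X : Type*} [NormedAddCommGroup X] [NormedSpace ℝ X] {T : C0Semigroup X}
  {U : Type*} [NormedAddCommGroup U] [NormedSpace ℝ U] {f : X → U → X} {η : ℝ≥0 → ℝ≥0}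

/-- Composing the closed-loop right-hand side with a radial retraction makes it globally
Lipschitz. -/
theorem isLipschitzField_closedLoop_radialRetraction (hf : SubstitutionMeasurable f)
    (hη : ClassKInfty η) (hL : ClosedLoopLipschitz f η) (d : Disturbance U) {R : ℝ} (hR : 0 < R) :
    ∃ L B : ℝ, IsLipschitzField (fun s x => closedLoop f η d s (radialRetraction R x)) L B := by
  obtain ⟨L, hL0, hL⟩ := hL (R + 1) (by positivity)
  have hlt : ∀ x : X, ‖radialRetraction R x‖ < R + 1 := fun x =>
    (norm_radialRetraction_le hR x).trans_lt (lt_add_one R)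
  refine ⟨L * 2, ‖f 0 0‖, ?_, ?_, ?_, by positivity⟩
  · intro x hx
    set y : ℝ → X := fun s => radialRetraction R (x s)
    have hy : Continuous y := (continuous_radialRetraction hR).comp hx
    have hmem : MemLp (fun s => (η ‖y s‖₊ : ℝ) • (d : Input U) s) ∞
        ((volume : Measure ℝ).restrict (Ici 0)) := by
      refine memLp_top_of_bound (aestronglyMeasurable_feedback hη.continuous d hy)
        (η R.toNNReal : ℝ) ?_
      filter_upwards [disturbance_ae_norm_le_one d] with s hs
      rw [norm_smul, NNReal.norm_eq]
      refine (mul_le_of_le_one_right (NNReal.coe_nonneg _) hs).trans ?_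
      rw [NNReal.coe_le_coe]
      refine hη.strictMono.monotone ?_
      rw [← norm_toNNReal]
      exact Real.toNNReal_le_toNNReal (norm_radialRetraction_le hR _)
    refine (hf y (hmem.toLp _) hy).congr ?_
    filter_upwards [hmem.coeFn_toLp] with s hs
    rw [hs]
    rfl
  · filter_upwards [disturbance_ae_norm_le_one d] with s hs x y
    refine (hL _ _ _ (hlt x) (hlt y) hs).trans ?_
    rw [mul_assoc]
    exact mul_le_mul_of_nonneg_left (norm_radialRetraction_sub_le hR x y) hL0.le
  · refine Eventually.of_forall fun s => ?_
    simp [closedLoop, radialRetraction, hη.map_zero]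

theorem closedLoop_eqOn [CompleteSpace X] (hf : SubstitutionMeasurable f) (hη : ClassKInfty η)
    (hL : ClosedLoopLipschitz f η) {x₀ : X} {d : Disturbance U} {τ : ℝ} {x y : ℝ → X}
    (hx : IsMildSolution T (closedLoop f η d) x₀ τ x)
    (hy : IsMildSolution T (closedLoop f η d) x₀ τ y) : EqOn x y (Icc 0 τ) := by
  obtain ⟨Cx, hCx⟩ := isCompact_Icc.exists_bound_of_continuousOn hx.continuousOn
  obtain ⟨Cy, hCy⟩ := isCompact_Icc.exists_bound_of_continuousOn hy.continuousOn
  set R : ℝ := max (max Cx Cy) 1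
  have hR : 0 < R := lt_max_of_lt_right one_pos
  obtain ⟨L, B, hg⟩ := isLipschitzField_closedLoop_radialRetraction hf hη hL d hR
  refine hg.eqOn_of_isMildSolution T
    (hx.congr (Eventually.of_forall fun s hs => ?_)) (hy.congr (Eventually.of_forall fun s hs => ?_))
  · rw [radialRetraction_of_norm_le hR
      ((hCx s hs).trans ((le_max_left _ _).trans (le_max_left _ _)))]
  · rw [radialRetraction_of_norm_le hR
      ((hCy s hs).trans ((le_max_right _ _).trans (le_max_left _ _)))]

/-- A closed-loop trajectory with disturbance `d` is the open-loop trajectory for the input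
`η(‖x‖) d`, which is dominated by it. -/
theorem RFCTrajectoryDominatedWith.closedLoop_norm_le (hwp : WellPosed T (openLoop f))
    (hη : ClassKInfty η) (h : RFCTrajectoryDominatedWith T f η) {C : ℝ} (hC : 0 < C) {b : ℝ}
    (hb : 0 ≤ b) :
    ∃ M : ℝ, ∀ (x₀ : X) (d : Disturbance U) (t : ℝ) (x : ℝ → X), ‖x₀‖ < C → 0 ≤ t → t < b →
      IsMildSolution T (closedLoop f η d) x₀ t x → ‖x t‖ ≤ M := by
  obtain ⟨M, hM⟩ := h.2 C hC b hb
  refine ⟨M, fun x₀ d t x hx₀ ht htb hx => ?_⟩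
  -- `y` extends `x` from `[0, t]` to a continuous path on the whole line
  set y : ℝ → X := IccExtend ht ((Icc 0 t).domRestrict x)
  have hy : Continuous y := hx.continuousOn.domRestrict.Icc_extend'
  have hyx : ∀ s ∈ Icc 0 t, y s = x s := fun s hs => IccExtend_of_mem ht _ hs
  obtain ⟨K, hK⟩ := isCompact_Icc.exists_bound_of_continuousOn
    (s := Icc 0 t) (f := fun s => (η ‖y s‖₊ : ℝ))
    (by have := hη.continuous; fun_prop : Continuous fun s => (η ‖y s‖₊ : ℝ)).continuousOn
  refine norm_le_of_dominated (η := η) hwp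
    (fun u hu r hr hrb => hM x₀ u hu r hx₀ hr hrb)
    (aestronglyMeasurable_feedback hη.continuous d hy) ht htb (K := K)
    (hx.congr (Eventually.of_forall fun s hs => ?_)) ?_ ?_
  · simp only [closedLoop, hyx s hs]
  · filter_upwards [disturbance_ae_norm_le_one d] with s hs hsI
    rw [norm_smul]
    exact (mul_le_of_le_one_right (norm_nonneg _) hs).trans (hK s hsI)
  · filter_upwards [disturbance_ae_norm_le_one d] with s hs hsI
    rw [hyx s hsI, ← NNReal.coe_le_coe, coe_nnnorm, norm_smul, NNReal.norm_eq]
    exact mul_le_of_le_one_right (NNReal.coe_nonneg _) hs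

/-- A solution of the truncated closed-loop system cannot reach the truncation radius, since up to
the first such time it solves the closed-loop system and obeys the a priori bound. -/
theorem RFCTrajectoryDominatedWith.closedLoop_forwardComplete [CompleteSpace X]
    (hf : SubstitutionMeasurable f) (hwp : WellPosed T (openLoop f)) (hη : ClassKInfty η)
    (hL : ClosedLoopLipschitz f η) (h : RFCTrajectoryDominatedWith T f η) :
    ForwardComplete T (closedLoop f η) := by
  intro x₀ d t ht
  obtain ⟨M, hM⟩ := h.closedLoop_norm_le hwp hη (C := ‖x₀‖ + 1) (by positivity)
    (b := t + 1) (by positivity)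
  set R : ℝ := max M ‖x₀‖ + 1
  have hR : 0 < R := by positivity
  have hMR : M < R := (le_max_left M ‖x₀‖).trans_lt (lt_add_one _)
  obtain ⟨L, B, hg⟩ := isLipschitzField_closedLoop_radialRetraction hf hη hL d hR
  obtain ⟨x, hx⟩ := hg.exists_isMildSolution T x₀ ht
  have hsol : ∀ r ≤ t, (∀ s ∈ Icc 0 r, ‖x s‖ ≤ R) →
      IsMildSolution T (closedLoop f η d) x₀ r x := fun r hr hle =>
    (hx.mono hr).congr (Eventually.of_forall fun s hs => by
      rw [radialRetraction_of_norm_le hR (hle s hs)])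
  refine ⟨x, hsol t le_rfl fun s hs => ?_⟩
  by_contra! hlt
  have hcomp : IsCompact (Icc 0 t ∩ (fun s => ‖x s‖) ⁻¹' Ici R) :=
    isCompact_Icc.of_isClosed_subset
      (hx.continuousOn.norm.preimage_isClosed_of_isClosed isClosed_Icc isClosed_Ici)
      inter_subset_left
  obtain ⟨a, ⟨haI, haR⟩, hmin⟩ := hcomp.exists_isLeast ⟨s, hs, hlt.le⟩
  have haR' : R ≤ ‖x a‖ := haR
  have h0R : ‖x 0‖ ≤ R := by
    rw [hx.apply_zero ht]
    exact (le_max_right M ‖x₀‖).trans (lt_add_one _).le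
  -- by minimality of `a` and the intermediate value theorem the radius is not exceeded at time `a`
  obtain ⟨b, hb, hbR⟩ := intermediate_value_Icc haI.1
    (hx.continuousOn.norm.mono (Icc_subset_Icc_right haI.2)) ⟨h0R, haR'⟩
  have hbR' : ‖x b‖ = R := hbR
  have hba : b = a := le_antisymm hb.2 (hmin ⟨⟨hb.1, hb.2.trans haI.2⟩, hbR'.ge⟩)
  have hle : ∀ r ∈ Icc 0 a, ‖x r‖ ≤ R := by
    intro r hr
    by_contra! hr'
    have hra : r = a := le_antisymm hr.2 (hmin ⟨⟨hr.1, hr.2.trans haI.2⟩, hr'.le⟩)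
    exact hr'.ne' (by rw [hra, ← hba, hbR'])
  exact absurd (hM x₀ d a x (lt_add_one _) haI.1 (by linarith [haI.2]) (hsol a haI.2 hle))
    (not_le.2 (hMR.trans_le haR'))

/-- An input dominated by its trajectory `x` is the feedback `η(‖x‖) d` for the disturbance
`d = u / η(‖x‖)` in the unit ball, so closed-loop bounds apply to it. -/
theorem RobustlyForwardComplete.rfcTrajectoryDominatedWith (hfc : ForwardComplete T (openLoop f))
    (hwp : WellPosed T (openLoop f)) (hη : ClassKInfty η) (hwpη : WellPosed T (closedLoop f η))
    (h : RobustlyForwardComplete T (closedLoop f η)) : RFCTrajectoryDominatedWith T f η := by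
  refine ⟨hfc, fun C hC τ hτ => ?_⟩
  obtain ⟨M, hM⟩ := h.2 C hC τ hτ
  refine ⟨M, fun x₀ u hu t hx₀ ht htτ => ?_⟩
  obtain ⟨x, hx⟩ := hfc x₀ u t ht
  have hfl : ∀ s ∈ Icc 0 t, flow T (openLoop f) s x₀ u = x s := fun s hs =>
    hx.flow_eq (hwp x₀ u).2 hs
  set y : ℝ → X := IccExtend ht ((Icc 0 t).domRestrict x)
  have hy : Continuous y := hx.continuousOn.domRestrict.Icc_extend'
  have hyx : ∀ s ∈ Icc 0 t, y s = x s := fun s hs => IccExtend_of_mem ht _ hs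
  have hudom : ∀ᵐ s ∂((volume : Measure ℝ).restrict (Ici 0)), s ∈ Icc 0 t →
      ‖u s‖ ≤ (η ‖y s‖₊ : ℝ) := by
    simp only [trajectoryDominated, mem_ofPred_eq] at hu
    filter_upwards [hu] with s hs hsI
    rw [hfl s hsI] at hs
    rw [hyx s hsI]
    exact_mod_cast hs
  -- where `η(‖y s‖) = 0` the inverse is `0` and `u s` vanishes, so this still is the quotient
  let w : ℝ → U := (Icc 0 t).indicator fun s => (η ‖y s‖₊ : ℝ)⁻¹ • u s
  have hwmeas : AEStronglyMeasurable w ((volume : Measure ℝ).restrict (Ici 0)) := by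
    have hc : Continuous fun s => (η ‖y s‖₊ : ℝ) := by
      have := hη.continuous
      fun_prop
    exact (hc.measurable.inv.aestronglyMeasurable.smul
      (Lp.aestronglyMeasurable u)).indicator measurableSet_Icc
  have hwle : ∀ᵐ s ∂((volume : Measure ℝ).restrict (Ici 0)), ‖w s‖ ≤ 1 := by
    filter_upwards [hudom] with s hs
    by_cases hsI : s ∈ Icc 0 t
    · simp only [w, indicator_of_mem hsI, norm_smul, norm_inv, NNReal.norm_eq]
      exact inv_mul_le_one_of_le₀ (hs hsI) (NNReal.coe_nonneg _)
    · simp [w, indicator_of_notMem hsI]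
  have hmem : MemLp w ∞ ((volume : Measure ℝ).restrict (Ici 0)) :=
    memLp_top_of_bound hwmeas 1 hwle
  have hnorm : ‖hmem.toLp w‖ ≤ 1 := by
    rw [Lp.norm_toLp]
    refine ENNReal.toReal_le_of_le_ofReal zero_le_one ?_
    rw [eLpNorm_exponent_top]
    exact eLpNormEssSup_le_of_ae_bound hwle
  let d : Disturbance U := ⟨hmem.toLp w, by simpa using hnorm⟩
  have hxd : IsMildSolution T (closedLoop f η d) x₀ t x := by
    refine hx.congr ?_
    filter_upwards [(ae_restrict_iff' measurableSet_Ici).1 hmem.coeFn_toLp,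
      (ae_restrict_iff' measurableSet_Ici).1 hudom] with s hs hus hsI
    have hds : (d : Input U) s = (η ‖x s‖₊ : ℝ)⁻¹ • u s := by
      rw [← hyx s hsI]
      exact (hs hsI.1).trans (indicator_of_mem hsI _)
    have hus' := hus hsI.1 hsI
    rw [hyx s hsI] at hus'
    simp only [openLoop, closedLoop, hds]
    congr 1
    by_cases h0 : (η ‖x s‖₊ : ℝ) = 0
    · rw [h0] at hus' ⊢
      rw [zero_smul]
      exact norm_le_zero_iff.1 hus'
    · rw [smul_inv_smul₀ h0]
  rw [hfl t ⟨ht, le_rfl⟩, ← hxd.flow_eq (hwpη x₀ d).2 ⟨ht, le_rfl⟩]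
  exact hM x₀ d t hx₀ ht htτ

theorem RFCTrajectoryDominatedWith.closedLoop_robustlyForwardComplete [CompleteSpace X]
    (hf : SubstitutionMeasurable f) (hwp : WellPosed T (openLoop f)) (hη : ClassKInfty η)
    (hL : ClosedLoopLipschitz f η) (h : RFCTrajectoryDominatedWith T f η) :
    WellPosed T (closedLoop f η) ∧ RobustlyForwardComplete T (closedLoop f η) := by
  have hfc := h.closedLoop_forwardComplete hf hwp hη hL
  refine ⟨fun x₀ d => ⟨⟨1, one_pos, hfc x₀ d 1 zero_le_one⟩, fun τ x y hx hy =>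
    closedLoop_eqOn hf hη hL hx hy⟩, hfc, fun C hC τ hτ => ?_⟩
  obtain ⟨M, hM⟩ := h.closedLoop_norm_le hwp hη hC hτ
  refine ⟨M, fun x₀ d t hx₀ ht htτ => ?_⟩
  obtain ⟨x, hx⟩ := hfc x₀ d t ht
  rw [hx.flow_eq (fun τ x y hx hy => closedLoop_eqOn hf hη hL hx hy) ⟨ht, le_rfl⟩]
  exact hM x₀ d t x hx₀ ht htτ hx

end ClosedLoop

end SemilinearEvolution

theorem mainTheorem4
    {X : Type*} [NormedAddCommGroup X] [NormedSpace ℝ X] [CompleteSpace X]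
    {U : Type*} [NormedAddCommGroup U] [NormedSpace ℝ U]
    (A : X →ₗ.[ℝ] X) (T : SemilinearEvolution.C0Semigroup X)
    (hA : SemilinearEvolution.IsGenerator A T)
    (f : X → U → X)
    (hf : SemilinearEvolution.SubstitutionMeasurable f)
    (hwp : SemilinearEvolution.WellPosed T (SemilinearEvolution.openLoop f))
    (h3 : ∃ η : ℝ≥0 → ℝ≥0, SemilinearEvolution.ClassKInfty η ∧ LipschitzWith 1 η ∧
      SemilinearEvolution.RFCTrajectoryDominatedWith T f η ∧
      SemilinearEvolution.ClosedLoopLipschitz f η) :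
    List.TFAE [
      ∃ η : ℝ≥0 → ℝ≥0, SemilinearEvolution.ClassKInfty η ∧
        SemilinearEvolution.WellPosed T (SemilinearEvolution.closedLoop f η) ∧
        SemilinearEvolution.RobustlyForwardComplete T (SemilinearEvolution.closedLoop f η),
      SemilinearEvolution.RFCTrajectoryDominated T f,
      SemilinearEvolution.BRS T (SemilinearEvolution.openLoop f)] := by
  obtain ⟨η, hη, -, hdom, hL⟩ := h3
  tfae_have 1 → 2 := fun ⟨ζ, hζ, hwpζ, hζr⟩ =>
    ⟨ζ, hζ, hζr.rfcTrajectoryDominatedWith hdom.1 hwp hζ hwpζ⟩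
  tfae_have 2 → 3 := fun ⟨ζ, hζ, hζd⟩ => hζd.brs hwp hζ
  -- the margin of the standing assumption serves here, since only it comes with a Lipschitz estimate
  tfae_have 3 → 1 := fun _ => ⟨η, hη, hdom.closedLoop_robustlyForwardComplete hf hwp hη hL⟩
  tfae_finish
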